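/- **Theorem 3.1.** Let $(\mathscr C,\mathbb E,\mathfrak s)$ be an extriangulated category. Then $\mathscr C$ has an $\mathbb E$-compatible triangulated structure $(\mathscr C,T,\mathcal T)$ if and only if, for every object $X\in\mathscr C$, the morphism $X\to 0$ is an $\mathbb E$-inflation and the morphism $0\to X$ is an $\mathbb E$-deflation. The terms are understood as follows. *Extriangulated category* (Nakaoka–Palu). $\mathscr C$ is an additive category, $\mathbb E\colon\mathscr C^{\mathrm{op}}\times\mathscr C\to \mathrm{Ab}$ is a biadditive functor (write $a_*\delta=\mathbb E(C,a)(\delta)$ and $c^*\delta=\mathbb E(c,A)(\delta)$ for $\delta\in\mathbb E(C,A)$), and $\mathfrak s$ assigns to each $\delta\in\mathbb E(C,A)$ an equivalence class $\mathfrak s(\delta)=[A\xrightarrow{x}B\xrightarrow{y}C]$ of sequences, where $(B,x,y)\sim(B',x',y')$ means that there is an isomorphism $b\colon B\to B'$ with $bx=x'$ and $y'b=y$; one says that the sequence *realises* $\delta$. The following hold. * (ET2) Let $\delta\in\mathbb E(C,A)$ and $\delta'\in\mathbb E(C',A')$ be realised by $A\xrightarrow{x}B\xrightarrow{y}C$ and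 $A'\xrightarrow{x'}B'\xrightarrow{y'}C'$. If $a\colon A\to A'$ and $c\colon C\to C'$ satisfy $a_*\delta=c^*\delta'$, then there is $b\colon B\to B'$ with $bx=x'a$ and $y'b=cy$. Moreover $0\in\mathbb E(C,A)$ is realised by the split sequence $A\to A\oplus C\to C$, and $(i_A)_*(p_C)^*\delta+(i_{A'})_*(p_{C'})^*\delta'$ is realised by the direct sum of the two sequences, where $i_A,i_{A'}$ are the inclusions into $A\oplus A'$ and $p_C,p_{C'}$ the projections from $C\oplus C'$. * (ET3) With $\delta,\delta'$ realised as above, if $a\colon A\to A'$ and $b\colon B\to B'$ satisfy $bx=x'a$, then there is $c\colon C\to C'$ with $a_*\delta=c^*\delta'$ and $y'b=cy$. * (ET4) If $\delta\in\mathbb E(D,A)$ is realised by $A\xrightarrow{f}B\xrightarrow{f'}D$ and $\delta'\in\mathbb E(F,B)$ by $B\xrightarrow{g}C\xrightarrow{g'}F$, then there are an object $E$, morphisms $h'\colon C\to E$, $d\colon D\to E$, $e\colon E\to F$ with $df'=h'g$ and $eh'=g'$, and $\delta''\in\mathbb E(E,A)$ realised by $A\xrightarrow{gf}C\xrightarrow{h'}E$,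 such that $(f')_*\delta'$ is realised by $D\xrightarrow{d}E\xrightarrow{e}F$, $d^*\delta''=\delta$ and $f_*\delta''=e^*\delta'$. * (ET3)$^{\mathrm{op}}$ and (ET4)$^{\mathrm{op}}$: the duals of (ET3) and (ET4). *Triangles, inflations, deflations.* If $A\xrightarrow{x}B\xrightarrow{y}C$ realises $\delta$, then $A\xrightarrow{x}B\xrightarrow{y}C\overset{\delta}{\dashrightarrow}$ is an *$\mathbb E$-triangle*, $x$ is an *$\mathbb E$-inflation* and $y$ is an *$\mathbb E$-deflation*. *Triangulated structure.* $T$ is an auto-equivalence of $\mathscr C$ and $\mathcal T$ is a class of sextuples $X\xrightarrow{u}Y\xrightarrow{v}Z\xrightarrow{w}TX$, called distinguished triangles, satisfying the usual axioms (TR1)–(TR4), including the octahedral axiom (TR4). *Compatibility.* $(\mathscr C,T,\mathcal T)$ is *$\mathbb E$-compatible* if for every distinguished triangle $X\xrightarrow{u}Y\xrightarrow{v}Z\xrightarrow{w}TX$ there is some $\delta\in\mathbb E(Z,X)$ such that $X\xrightarrow{u}Y\xrightarrow{v}Z\overset{\delta}{\dashrightarrow}$ is an $\mathbb E$-triangle.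 -/

import Mathlib

open CategoryTheory CategoryTheory.Limits Opposite
open scoped ZeroObject

universe w v u

noncomputable section

namespace Extriangulated

/-- A sequence of two morphisms `A ⟶ B ⟶ C` with prescribed end terms `A` and `C`. -/
structure Seq {𝒞 : Type u} [Category.{v} 𝒞] (A C : 𝒞) where
  /-- the middle term -/
  mid : 𝒞
  /-- the first morphism -/
  fst : A ⟶ mid
  /-- the second morphism -/
  snd : mid ⟶ C

/-- Two sequences with the same end terms are equivalent if there is an isomorphism between
their middle terms which, with the identities of the end terms, makes both squares commute. -/
def Seq.Equivalent {𝒞 : Type u} [Category.{v} 𝒞] {A C : 𝒞} (S S' : Seq A C) : Prop :=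
  ∃ b : S.mid ≅ S'.mid, S.fst ≫ b.hom = S'.fst ∧ b.hom ≫ S'.snd = S.snd

/-- Equivalence of sequences, as a setoid. -/
def Seq.setoid {𝒞 : Type u} [Category.{v} 𝒞] (A C : 𝒞) : Setoid (Seq A C) where
  r := Seq.Equivalent
  iseqv :=
    { refl := fun S => ⟨Iso.refl _, by simp, by simp⟩
      symm := by
        rintro S S' ⟨b, h₁, h₂⟩
        exact ⟨b.symm, by simp [← h₁], by simp [← h₂]⟩
      trans := by
        rintro S S' S'' ⟨b, h₁, h₂⟩ ⟨b', h₁', h₂'⟩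
        exact ⟨b ≪≫ b', by simp [← h₁', ← h₁], by simp [← h₂, ← h₂']⟩ }

/-- The equivalence classes of sequences `A ⟶ B ⟶ C` with fixed end terms. -/
def SeqClass {𝒞 : Type u} [Category.{v} 𝒞] (A C : 𝒞) : Type (max u v) :=
  Quotient (Seq.setoid A C)

/-- The equivalence class `[A ⟶ B ⟶ C]`. -/
def SeqClass.mk {𝒞 : Type u} [Category.{v} 𝒞] {A B C : 𝒞} (x : A ⟶ B) (y : B ⟶ C) :
    SeqClass A C :=
  Quotient.mk (Seq.setoid A C) ⟨B, x, y⟩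

/-- The abelian group `𝔼(C, A)` of `𝔼`-extensions, for a bifunctor `𝔼 : 𝒞ᵒᵖ × 𝒞 ⥤ Ab`
(in curried form). -/
abbrev Ext {𝒞 : Type u} [Category.{v} 𝒞] (𝔼 : 𝒞ᵒᵖ ⥤ 𝒞 ⥤ AddCommGrpCat.{w}) (C A : 𝒞) : Type w :=
  (𝔼.obj (op C)).obj A

/-- `a_* δ = 𝔼(C, a)(δ)`. -/
def push {𝒞 : Type u} [Category.{v} 𝒞] (𝔼 : 𝒞ᵒᵖ ⥤ 𝒞 ⥤ AddCommGrpCat.{w}) {A A' C : 𝒞}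
    (a : A ⟶ A') (δ : Ext 𝔼 C A) : Ext 𝔼 C A' :=
  ((𝔼.obj (op C)).map a).hom δ

/-- `c^* δ = 𝔼(c, A)(δ)`. -/
def pull {𝒞 : Type u} [Category.{v} 𝒞] (𝔼 : 𝒞ᵒᵖ ⥤ 𝒞 ⥤ AddCommGrpCat.{w}) {A C C' : 𝒞}
    (c : C' ⟶ C) (δ : Ext 𝔼 C A) : Ext 𝔼 C' A :=
  ((𝔼.map c.op).app A).hom δ

end Extriangulated

open Extriangulated in
/-- An extriangulated structure `(𝔼, 𝔰)` on an additive category `𝒞`. -/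
structure ExtriangulatedStructure (𝒞 : Type u) [Category.{v} 𝒞] [Preadditive 𝒞]
    [HasZeroObject 𝒞] [HasBinaryBiproducts 𝒞] where
  /-- the bifunctor `𝔼 : 𝒞ᵒᵖ × 𝒞 ⥤ Ab` -/
  𝔼 : 𝒞ᵒᵖ ⥤ 𝒞 ⥤ AddCommGrpCat.{w}
  /-- (ET1) `𝔼` is additive in the covariant variable -/
  additive_right : ∀ C : 𝒞, (𝔼.obj (op C)).Additive
  /-- (ET1) `𝔼` is additive in the contravariant variable -/
  additive_left : ∀ A : 𝒞, (𝔼.flip.obj A).Additive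
  /-- the correspondence `𝔰`, sending an extension to an equivalence class of sequences -/
  𝔰 : ∀ {A C : 𝒞}, Ext 𝔼 C A → SeqClass A C
  /-- (ET2) `𝔰` is a realisation: every morphism of extensions is realised -/
  realisation : ∀ {A B C A' B' C' : 𝒞} (δ : Ext 𝔼 C A) (δ' : Ext 𝔼 C' A')
    (x : A ⟶ B) (y : B ⟶ C) (x' : A' ⟶ B') (y' : B' ⟶ C'),
    𝔰 δ = SeqClass.mk x y → 𝔰 δ' = SeqClass.mk x' y' →
    ∀ (a : A ⟶ A') (c : C ⟶ C'), push 𝔼 a δ = pull 𝔼 c δ' →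
      ∃ b : B ⟶ B', x ≫ b = a ≫ x' ∧ y ≫ c = b ≫ y'
  /-- (ET2) split extensions are realised by split sequences -/
  realisation_zero : ∀ A C : 𝒞,
    𝔰 (0 : Ext 𝔼 C A) = SeqClass.mk (biprod.inl : A ⟶ A ⊞ C) (biprod.snd : A ⊞ C ⟶ C)
  /-- (ET2) direct sums of extensions are realised by direct sums of sequences -/
  realisation_add : ∀ {A B C A' B' C' : 𝒞} (δ : Ext 𝔼 C A) (δ' : Ext 𝔼 C' A')
    (x : A ⟶ B) (y : B ⟶ C) (x' : A' ⟶ B') (y' : B' ⟶ C'),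
    𝔰 δ = SeqClass.mk x y → 𝔰 δ' = SeqClass.mk x' y' →
    𝔰 (push 𝔼 (biprod.inl : A ⟶ A ⊞ A') (pull 𝔼 (biprod.fst : C ⊞ C' ⟶ C) δ) +
        push 𝔼 (biprod.inr : A' ⟶ A ⊞ A') (pull 𝔼 (biprod.snd : C ⊞ C' ⟶ C') δ')) =
      SeqClass.mk (biprod.map x x') (biprod.map y y')
  /-- (ET3) -/
  et3 : ∀ {A B C A' B' C' : 𝒞} (δ : Ext 𝔼 C A) (δ' : Ext 𝔼 C' A')
    (x : A ⟶ B) (y : B ⟶ C) (x' : A' ⟶ B') (y' : B' ⟶ C'),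
    𝔰 δ = SeqClass.mk x y → 𝔰 δ' = SeqClass.mk x' y' →
    ∀ (a : A ⟶ A') (b : B ⟶ B'), x ≫ b = a ≫ x' →
      ∃ c : C ⟶ C', push 𝔼 a δ = pull 𝔼 c δ' ∧ y ≫ c = b ≫ y'
  /-- (ET3)ᵒᵖ -/
  et3op : ∀ {A B C A' B' C' : 𝒞} (δ : Ext 𝔼 C A) (δ' : Ext 𝔼 C' A')
    (x : A ⟶ B) (y : B ⟶ C) (x' : A' ⟶ B') (y' : B' ⟶ C'),
    𝔰 δ = SeqClass.mk x y → 𝔰 δ' = SeqClass.mk x' y' →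
    ∀ (b : B ⟶ B') (c : C ⟶ C'), y ≫ c = b ≫ y' →
      ∃ a : A ⟶ A', push 𝔼 a δ = pull 𝔼 c δ' ∧ x ≫ b = a ≫ x'
  /-- (ET4) -/
  et4 : ∀ {A B C D F : 𝒞} (δ : Ext 𝔼 D A) (δ' : Ext 𝔼 F B)
    (f : A ⟶ B) (f' : B ⟶ D) (g : B ⟶ C) (g' : C ⟶ F),
    𝔰 δ = SeqClass.mk f f' → 𝔰 δ' = SeqClass.mk g g' →
    ∃ (E : 𝒞) (h' : C ⟶ E) (d : D ⟶ E) (e : E ⟶ F) (δ'' : Ext 𝔼 E A),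
      f' ≫ d = g ≫ h' ∧ h' ≫ e = g' ∧
      𝔰 δ'' = SeqClass.mk (f ≫ g) h' ∧
      𝔰 (push 𝔼 f' δ') = SeqClass.mk d e ∧
      pull 𝔼 d δ'' = δ ∧
      push 𝔼 f δ'' = pull 𝔼 e δ'
  /-- (ET4)ᵒᵖ, obtained from (ET4) by reversing all arrows and exchanging `push` and `pull` -/
  et4op : ∀ {A B C D F : 𝒞} (δ : Ext 𝔼 A D) (δ' : Ext 𝔼 B F)
    (f' : D ⟶ B) (f : B ⟶ A) (g' : F ⟶ C) (g : C ⟶ B),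
    𝔰 δ = SeqClass.mk f' f → 𝔰 δ' = SeqClass.mk g' g →
    ∃ (E : 𝒞) (h' : E ⟶ C) (d : E ⟶ D) (e : F ⟶ E) (δ'' : Ext 𝔼 A E),
      d ≫ f' = h' ≫ g ∧ e ≫ h' = g' ∧
      𝔰 δ'' = SeqClass.mk h' (g ≫ f) ∧
      𝔰 (pull 𝔼 f' δ') = SeqClass.mk e d ∧
      push 𝔼 d δ'' = δ ∧
      pull 𝔼 f δ'' = push 𝔼 e δ'

namespace ExtriangulatedStructure

open Extriangulated

/-- `A ⟶ B ⟶ C`, together with `δ`, is an `𝔼`-triangle: the sequence realises `δ`. -/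
def IsETriangle {𝒞 : Type u} [Category.{v} 𝒞] [Preadditive 𝒞] [HasZeroObject 𝒞]
    [HasBinaryBiproducts 𝒞] (𝓔 : ExtriangulatedStructure.{w} 𝒞) {A B C : 𝒞}
    (x : A ⟶ B) (y : B ⟶ C) (δ : Ext 𝓔.𝔼 C A) : Prop :=
  𝓔.𝔰 δ = SeqClass.mk x y

/-- `A ⟶ B ⟶ C` is an `𝔼`-conflation: it realises some extension. -/
def IsConflation {𝒞 : Type u} [Category.{v} 𝒞] [Preadditive 𝒞] [HasZeroObject 𝒞]
    [HasBinaryBiproducts 𝒞] (𝓔 : ExtriangulatedStructure.{w} 𝒞) {A B C : 𝒞}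
    (x : A ⟶ B) (y : B ⟶ C) : Prop :=
  ∃ δ : Ext 𝓔.𝔼 C A, 𝓔.IsETriangle x y δ

/-- `f` is an `𝔼`-inflation: it is the first morphism of some conflation. -/
def IsInflation {𝒞 : Type u} [Category.{v} 𝒞] [Preadditive 𝒞] [HasZeroObject 𝒞]
    [HasBinaryBiproducts 𝒞] (𝓔 : ExtriangulatedStructure.{w} 𝒞) {A B : 𝒞} (f : A ⟶ B) : Prop :=
  ∃ (C : 𝒞) (y : B ⟶ C), 𝓔.IsConflation f y

/-- `g` is an `𝔼`-deflation: it is the second morphism of some conflation. -/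
def IsDeflation {𝒞 : Type u} [Category.{v} 𝒞] [Preadditive 𝒞] [HasZeroObject 𝒞]
    [HasBinaryBiproducts 𝒞] (𝓔 : ExtriangulatedStructure.{w} 𝒞) {B C : 𝒞} (g : B ⟶ C) : Prop :=
  ∃ (A : 𝒞) (x : A ⟶ B), 𝓔.IsConflation x g

end ExtriangulatedStructure

/-- A triangulated structure `(T, 𝒯)` on an additive category, where `T` is an arbitrary
auto-equivalence. (Mathlib's `Pretriangulated` is relative to a coherent action of `ℤ` by shift
functors, which is more data than the single auto-equivalence `T`.) An equivalence of additive
categories is automatically additive, so additivity of `T` is not a separate axiom. -/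
structure TriangulatedStructure (𝒞 : Type u) [Category.{v} 𝒞] [Preadditive 𝒞]
    [HasZeroObject 𝒞] [HasBinaryBiproducts 𝒞] where
  /-- the auto-equivalence -/
  T : 𝒞 ⥤ 𝒞
  /-- `T` is an equivalence of categories -/
  isEquivalence : T.IsEquivalence
  /-- the class `𝒯` of distinguished triangles `X ⟶ Y ⟶ Z ⟶ T X` -/
  Dist : ∀ {X Y Z : 𝒞}, (X ⟶ Y) → (Y ⟶ Z) → (Z ⟶ T.obj X) → Prop
  /-- (TR1) a sextuple isomorphic to a distinguished triangle is distinguished -/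
  tr1_iso : ∀ {X Y Z X' Y' Z' : 𝒞} (u : X ⟶ Y) (v : Y ⟶ Z) (w : Z ⟶ T.obj X)
    (u' : X' ⟶ Y') (v' : Y' ⟶ Z') (w' : Z' ⟶ T.obj X') (f : X ≅ X') (g : Y ≅ Y') (h : Z ≅ Z'),
    u ≫ g.hom = f.hom ≫ u' → v ≫ h.hom = g.hom ≫ v' → w ≫ T.map f.hom = h.hom ≫ w' →
    Dist u v w → Dist u' v' w'
  /-- (TR1) every morphism embeds into a distinguished triangle -/
  tr1_exists : ∀ {X Y : 𝒞} (u : X ⟶ Y),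
    ∃ (Z : 𝒞) (v : Y ⟶ Z) (w : Z ⟶ T.obj X), Dist u v w
  /-- (TR1) the triangle `X ⟶ X ⟶ 0 ⟶ T X` given by the identity is distinguished -/
  tr1_id : ∀ X : 𝒞, Dist (𝟙 X) (0 : X ⟶ (0 : 𝒞)) (0 : (0 : 𝒞) ⟶ T.obj X)
  /-- (TR2) rotation -/
  tr2 : ∀ {X Y Z : 𝒞} (u : X ⟶ Y) (v : Y ⟶ Z) (w : Z ⟶ T.obj X),
    Dist u v w → Dist v w (-(T.map u))
  /-- (TR3) completion of a commutative square to a morphism of triangles -/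
  tr3 : ∀ {X Y Z X' Y' Z' : 𝒞} (u : X ⟶ Y) (v : Y ⟶ Z) (w : Z ⟶ T.obj X)
    (u' : X' ⟶ Y') (v' : Y' ⟶ Z') (w' : Z' ⟶ T.obj X'), Dist u v w → Dist u' v' w' →
    ∀ (f : X ⟶ X') (g : Y ⟶ Y'), u ≫ g = f ≫ u' →
      ∃ h : Z ⟶ Z', v ≫ h = g ≫ v' ∧ w ≫ T.map f = h ≫ w'
  /-- (TR4) the octahedral axiom -/
  tr4 : ∀ {X Y Z X' Y' Z' : 𝒞} (u : X ⟶ Y) (i : Y ⟶ Z') (i' : Z' ⟶ T.obj X)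
    (v : Y ⟶ Z) (j : Z ⟶ X') (j' : X' ⟶ T.obj Y) (k : Z ⟶ Y') (k' : Y' ⟶ T.obj X),
    Dist u i i' → Dist v j j' → Dist (u ≫ v) k k' →
    ∃ (f : Z' ⟶ Y') (g : Y' ⟶ X'),
      i ≫ f = v ≫ k ∧ f ≫ k' = i' ∧ k ≫ g = j ∧ k' ≫ T.map u = g ≫ j' ∧
      Dist f g (j' ≫ T.map i)

/-- A triangulated structure is `𝔼`-compatible if every distinguished triangle
`X ⟶ Y ⟶ Z ⟶ T X` yields an `𝔼`-triangle `X ⟶ Y ⟶ Z ⇢ δ` for some `δ ∈ 𝔼(Z, X)`. -/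
def TriangulatedStructure.IsCompatible {𝒞 : Type u} [Category.{v} 𝒞] [Preadditive 𝒞]
    [HasZeroObject 𝒞] [HasBinaryBiproducts 𝒞] (𝓣 : TriangulatedStructure 𝒞)
    (𝓔 : ExtriangulatedStructure.{w} 𝒞) : Prop :=
  ∀ {X Y Z : 𝒞} (u : X ⟶ Y) (v : Y ⟶ Z) (w : Z ⟶ 𝓣.T.obj X), 𝓣.Dist u v w →
    ∃ δ : Extriangulated.Ext 𝓔.𝔼 Z X, 𝓔.IsETriangle u v δ

end

/-!
If `A ⟶ 0 ⟶ C` realises `δ`, then the long exact sequences show that `δ` is universal on both sides: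
`c ↦ c^* δ` and `a ↦ a_* δ` are bijections `Hom(W, C) ≃ 𝔼(W, A)` and `Hom(A, W) ≃ 𝔼(C, W)`. Hence if
every `X ⟶ 0` is an inflation, then `𝔼(-, X)` is represented by an object `T X`, naturally in `X`,
and `T` is an equivalence once every `0 ⟶ X` is a deflation. Under `𝔼(Z, X) ≃ Hom(Z, T X)`, the
distinguished triangles are the `𝔼`-triangles. (TR3) and (TR4) are (ET3) and (ET4), while the
existence of cones and their rotation come from (ET4) applied to the graph `A ⟶ A ⊞ Y` of
`u : A ⟶ Y`, followed by the sum of `A ⟶ 0` and `𝟙 Y`. Conversely, every morphism of a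
triangulated category starts a distinguished triangle, and rotating the triangle of `𝟙 X` shows that
`0 ⟶ T X` is the second morphism of one; compatibility turns these into `𝔼`-triangles.
-/

namespace Extriangulated

variable {𝒞 : Type u} [Category.{v} 𝒞]

theorem isIso_of_isIso_comp_of_isIso_comp {W X Y Z : 𝒞} (f : W ⟶ X) (g : X ⟶ Y) (h : Y ⟶ Z)
    [IsIso (f ≫ g)] [IsIso (g ≫ h)] : IsIso g := by
  have : IsSplitMono g := ⟨⟨h ≫ inv (g ≫ h), by rw [← Category.assoc, IsIso.hom_inv_id]⟩⟩
  have : IsSplitEpi g := ⟨⟨inv (f ≫ g) ≫ f, by rw [Category.assoc, IsIso.inv_hom_id]⟩⟩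
  exact isIso_of_mono_of_isSplitEpi g

theorem isIso_of_isNilpotent_sub_one [Preadditive 𝒞] {X : 𝒞} {f : End X}
    (h : IsNilpotent (f - 1)) : IsIso f := by
  have hf : IsUnit (1 + (f - 1)) := h.isUnit_one_add
  rw [add_sub_cancel] at hf
  exact (isUnit_iff_isIso f).1 hf

theorem SeqClass.mk_eq_mk_iff {A B B' C : 𝒞} {x : A ⟶ B} {y : B ⟶ C} {x' : A ⟶ B'}
    {y' : B' ⟶ C} : SeqClass.mk x y = SeqClass.mk x' y' ↔
      ∃ b : B ≅ B', x ≫ b.hom = x' ∧ b.hom ≫ y' = y :=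
  Quotient.eq

theorem SeqClass.exists_eq_mk {A C : 𝒞} (S : SeqClass A C) :
    ∃ (B : 𝒞) (x : A ⟶ B) (y : B ⟶ C), S = SeqClass.mk x y := by
  obtain ⟨⟨B, x, y⟩, rfl⟩ := Quotient.exists_rep S
  exact ⟨B, x, y, rfl⟩

variable (𝔼 : 𝒞ᵒᵖ ⥤ 𝒞 ⥤ AddCommGrpCat.{w}) {A A' A'' C C' C'' : 𝒞}

@[simp]
theorem push_id (δ : Ext 𝔼 C A) : push 𝔼 (𝟙 A) δ = δ := by
  simp [push]

@[simp]
theorem pull_id (δ : Ext 𝔼 C A) : pull 𝔼 (𝟙 C) δ = δ := by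
  simp [pull]

theorem push_comp (a : A ⟶ A') (a' : A' ⟶ A'') (δ : Ext 𝔼 C A) :
    push 𝔼 (a ≫ a') δ = push 𝔼 a' (push 𝔼 a δ) := by
  simp [push]

theorem pull_comp (c : C'' ⟶ C') (c' : C' ⟶ C) (δ : Ext 𝔼 C A) :
    pull 𝔼 (c ≫ c') δ = pull 𝔼 c (pull 𝔼 c' δ) := by
  simp [pull]

theorem push_pull (a : A ⟶ A') (c : C' ⟶ C) (δ : Ext 𝔼 C A) :
    push 𝔼 a (pull 𝔼 c δ) = pull 𝔼 c (push 𝔼 a δ) :=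
  (ConcreteCategory.congr_hom ((𝔼.map c.op).naturality a) δ).symm

@[simp]
theorem push_zero (a : A ⟶ A') : push 𝔼 a (0 : Ext 𝔼 C A) = 0 :=
  map_zero _

@[simp]
theorem pull_zero (c : C' ⟶ C) : pull 𝔼 c (0 : Ext 𝔼 C A) = 0 :=
  map_zero _

variable {𝔼} in
theorem push_inv_eq_pull_inv {δ : Ext 𝔼 C A} {δ' : Ext 𝔼 C' A'} {a : A ≅ A'} {c : C ≅ C'}
    (h : push 𝔼 a.hom δ = pull 𝔼 c.hom δ') : push 𝔼 a.inv δ' = pull 𝔼 c.inv δ := by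
  calc push 𝔼 a.inv δ' = push 𝔼 a.inv (pull 𝔼 c.inv (pull 𝔼 c.hom δ')) := by
        rw [← pull_comp, c.inv_hom_id, pull_id]
    _ = pull 𝔼 c.inv (push 𝔼 a.inv (push 𝔼 a.hom δ)) := by rw [← h, push_pull]
    _ = pull 𝔼 c.inv δ := by rw [← push_comp, a.hom_inv_id, push_id]

end Extriangulated

namespace ExtriangulatedStructure

open Extriangulated

variable {𝒞 : Type u} [Category.{v} 𝒞] [Preadditive 𝒞] [HasZeroObject 𝒞]
  [HasBinaryBiproducts 𝒞]

section Additivity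

variable (𝓔 : ExtriangulatedStructure.{w} 𝒞) {A A' C C' : 𝒞}

theorem sub_push (a a' : A ⟶ A') (δ : Ext 𝓔.𝔼 C A) :
    push 𝓔.𝔼 (a - a') δ = push 𝓔.𝔼 a δ - push 𝓔.𝔼 a' δ := by
  have := 𝓔.additive_right C
  simp [push, Functor.map_sub]

theorem sub_pull (c c' : C' ⟶ C) (δ : Ext 𝓔.𝔼 C A) :
    pull 𝓔.𝔼 (c - c') δ = pull 𝓔.𝔼 c δ - pull 𝓔.𝔼 c' δ := by
  have := 𝓔.additive_left A
  exact ConcreteCategory.congr_hom ((𝓔.𝔼.flip.obj A).map_sub (f := c.op) (g := c'.op)) δ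

@[simp]
theorem zero_push (δ : Ext 𝓔.𝔼 C A) : push 𝓔.𝔼 (0 : A ⟶ A') δ = 0 := by
  simpa using 𝓔.sub_push (0 : A ⟶ A') 0 δ

@[simp]
theorem zero_pull (δ : Ext 𝓔.𝔼 C A) : pull 𝓔.𝔼 (0 : C' ⟶ C) δ = 0 := by
  simpa using 𝓔.sub_pull (0 : C' ⟶ C) 0 δ

theorem neg_push (a : A ⟶ A') (δ : Ext 𝓔.𝔼 C A) : push 𝓔.𝔼 (-a) δ = -push 𝓔.𝔼 a δ := by
  simpa using 𝓔.sub_push 0 a δ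

theorem neg_pull (c : C' ⟶ C) (δ : Ext 𝓔.𝔼 C A) : pull 𝓔.𝔼 (-c) δ = -pull 𝓔.𝔼 c δ := by
  simpa using 𝓔.sub_pull 0 c δ

end Additivity

variable {𝓔 : ExtriangulatedStructure.{w} 𝒞}

namespace IsETriangle

variable {A B C A' B' C' : 𝒞} {x : A ⟶ B} {y : B ⟶ C} {δ : Ext 𝓔.𝔼 C A}
  {x' : A' ⟶ B'} {y' : B' ⟶ C'} {δ' : Ext 𝓔.𝔼 C' A'}

theorem exists_realisation (δ : Ext 𝓔.𝔼 C A) :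
    ∃ (B : 𝒞) (x : A ⟶ B) (y : B ⟶ C), 𝓔.IsETriangle x y δ :=
  (𝓔.𝔰 δ).exists_eq_mk

theorem comp_iso (h : 𝓔.IsETriangle x y δ) (b : B ≅ B') :
    𝓔.IsETriangle (x ≫ b.hom) (b.inv ≫ y) δ :=
  Eq.trans h (SeqClass.mk_eq_mk_iff.2 ⟨b, rfl, b.hom_inv_id_assoc y⟩)

theorem of_splitting {S : ShortComplex 𝒞} (σ : S.Splitting) : 𝓔.IsETriangle S.f S.g 0 := by
  have h : 𝓔.IsETriangle (biprod.inl : S.X₁ ⟶ S.X₁ ⊞ S.X₃) biprod.snd 0 :=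
    𝓔.realisation_zero S.X₁ S.X₃
  simpa using h.comp_iso σ.isoBinaryBiproduct.symm

theorem zero_id (C : 𝒞) : 𝓔.IsETriangle (0 : (0 : 𝒞) ⟶ C) (𝟙 C) 0 :=
  of_splitting (S := .mk 0 (𝟙 C) zero_comp) (.ofIsZeroOfIsIso _ (isZero_zero 𝒞) inferInstance)

theorem id_zero (A : 𝒞) : 𝓔.IsETriangle (𝟙 A) (0 : A ⟶ (0 : 𝒞)) 0 :=
  of_splitting (S := .mk (𝟙 A) 0 comp_zero) (.ofIsIsoOfIsZero _ inferInstance (isZero_zero 𝒞))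

theorem graph {Y : 𝒞} (u : A ⟶ Y) :
    𝓔.IsETriangle (biprod.lift (𝟙 A) u) (biprod.desc (-u) (𝟙 Y)) 0 :=
  of_splitting (S := .mk (biprod.lift (𝟙 A) u) (biprod.desc (-u) (𝟙 Y)) (by simp))
    { r := biprod.fst
      s := biprod.inr
      id := by ext <;> simp }

section Exactness

variable {W : 𝒞}

theorem exists_desc (h : 𝓔.IsETriangle x y δ) (t : B ⟶ W) (ht : x ≫ t = 0) :
    ∃ s : C ⟶ W, y ≫ s = t := by
  obtain ⟨s, -, hs⟩ := 𝓔.et3 δ 0 x y _ _ h (zero_id W) 0 t (by simp [ht])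
  exact ⟨s, by simpa using hs⟩

theorem exists_extend (h : 𝓔.IsETriangle x y δ) (t : A ⟶ W) (ht : push 𝓔.𝔼 t δ = 0) :
    ∃ s : B ⟶ W, x ≫ s = t := by
  obtain ⟨s, hs, -⟩ := 𝓔.realisation δ 0 x y _ _ h (id_zero W) t 0 (by simp [ht])
  exact ⟨s, by simpa using hs⟩

theorem exists_lift (h : 𝓔.IsETriangle x y δ) (t : W ⟶ C) (ht : pull 𝓔.𝔼 t δ = 0) :
    ∃ s : W ⟶ B, s ≫ y = t := by
  obtain ⟨s, -, hs⟩ := 𝓔.realisation 0 δ _ _ x y (zero_id W) h 0 t (by simp [ht])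
  exact ⟨s, by simpa using hs.symm⟩

theorem exists_pull_eq (h : 𝓔.IsETriangle x y δ) (ε : Ext 𝓔.𝔼 W A) (hε : push 𝓔.𝔼 x ε = 0) :
    ∃ c : W ⟶ C, pull 𝓔.𝔼 c δ = ε := by
  obtain ⟨M, m, n, hM⟩ := exists_realisation ε
  obtain ⟨s, hs⟩ := hM.exists_extend x hε
  obtain ⟨c, hc, -⟩ := 𝓔.et3 ε δ _ _ _ _ hM h (𝟙 A) s (by simp [hs])
  exact ⟨c, by simpa using hc.symm⟩

theorem exists_push_eq (h : 𝓔.IsETriangle x y δ) (ε : Ext 𝓔.𝔼 C W) (hε : pull 𝓔.𝔼 y ε = 0) :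
    ∃ a : A ⟶ W, push 𝓔.𝔼 a δ = ε := by
  obtain ⟨M, m, n, hM⟩ := exists_realisation ε
  obtain ⟨s, hs⟩ := hM.exists_lift y hε
  obtain ⟨a, ha, -⟩ := 𝓔.et3op δ ε _ _ _ _ h hM s (𝟙 C) (by simp [hs])
  exact ⟨a, by simpa using ha⟩

end Exactness

section Isomorphisms

theorem isIso_mid_of_endo (h : 𝓔.IsETriangle x y δ) (b : B ⟶ B) (hx : x ≫ b = x)
    (hy : b ≫ y = y) : IsIso b := by
  obtain ⟨s, hs⟩ := h.exists_desc (b - 𝟙 B) (by simp [hx])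
  refine isIso_of_isNilpotent_sub_one ⟨2, (pow_two _).trans ?_⟩
  calc (b - 𝟙 B) ≫ (b - 𝟙 B) = ((b - 𝟙 B) ≫ y) ≫ s := by rw [Category.assoc, hs]
    _ = 0 := by simp [hy]

theorem isIso_right_of_endo (h : 𝓔.IsETriangle x y δ) (c : C ⟶ C) (hy : y ≫ c = y)
    (hc : pull 𝓔.𝔼 c δ = δ) : IsIso c := by
  obtain ⟨s, hs⟩ := h.exists_lift (c - 𝟙 C) (by simp [sub_pull, hc])
  refine isIso_of_isNilpotent_sub_one ⟨2, (pow_two _).trans ?_⟩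
  calc (c - 𝟙 C) ≫ (c - 𝟙 C) = s ≫ y ≫ (c - 𝟙 C) := by rw [← Category.assoc, hs]
    _ = 0 := by simp [hy]

theorem exists_iso_mid (h : 𝓔.IsETriangle x y δ) (h' : 𝓔.IsETriangle x' y' δ') (a : A ≅ A')
    (c : C ≅ C') (hδ : push 𝓔.𝔼 a.hom δ = pull 𝓔.𝔼 c.hom δ') :
    ∃ b : B ≅ B', x ≫ b.hom = a.hom ≫ x' ∧ y ≫ c.hom = b.hom ≫ y' := by
  obtain ⟨p, hp, hp'⟩ := 𝓔.realisation δ δ' _ _ _ _ h h' a.hom c.hom hδ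
  obtain ⟨q, hq, hq'⟩ := 𝓔.realisation δ' δ _ _ _ _ h' h a.inv c.inv (push_inv_eq_pull_inv hδ)
  have : IsIso (p ≫ q) := h.isIso_mid_of_endo _
    (by rw [reassoc_of% hp, hq, a.hom_inv_id_assoc])
    (by rw [Category.assoc, ← hq', ← reassoc_of% hp', c.hom_inv_id, Category.comp_id])
  have : IsIso (q ≫ p) := h'.isIso_mid_of_endo _
    (by rw [reassoc_of% hq, hp, a.inv_hom_id_assoc])
    (by rw [Category.assoc, ← hp', ← reassoc_of% hq', c.inv_hom_id, Category.comp_id])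
  have : IsIso p := isIso_of_isIso_comp_of_isIso_comp q p q
  exact ⟨asIso p, hp, hp'⟩

theorem exists_iso_right {y' : B ⟶ C'} {δ' : Ext 𝓔.𝔼 C' A} (h : 𝓔.IsETriangle x y δ)
    (h' : 𝓔.IsETriangle x y' δ') : ∃ c : C ≅ C', y ≫ c.hom = y' ∧ pull 𝓔.𝔼 c.hom δ' = δ := by
  obtain ⟨p, hp, hp'⟩ := 𝓔.et3 δ δ' _ _ _ _ h h' (𝟙 A) (𝟙 B) (by simp)
  obtain ⟨q, hq, hq'⟩ := 𝓔.et3 δ' δ _ _ _ _ h' h (𝟙 A) (𝟙 B) (by simp)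
  simp only [push_id, Category.id_comp] at hp hp' hq hq'
  have : IsIso (p ≫ q) := h.isIso_right_of_endo _ (by rw [reassoc_of% hp', hq'])
    (by rw [pull_comp, ← hq, hp])
  have : IsIso (q ≫ p) := h'.isIso_right_of_endo _ (by rw [reassoc_of% hq', hp'])
    (by rw [pull_comp, ← hp, hq])
  have : IsIso p := isIso_of_isIso_comp_of_isIso_comp q p q
  exact ⟨asIso p, hp', hp.symm⟩

theorem of_iso (h : 𝓔.IsETriangle x y δ) (a : A ≅ A') (b : B ≅ B') (c : C ≅ C')
    (hx : x ≫ b.hom = a.hom ≫ x') (hy : y ≫ c.hom = b.hom ≫ y')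
    (hδ : push 𝓔.𝔼 a.hom δ = pull 𝓔.𝔼 c.hom δ') : 𝓔.IsETriangle x' y' δ' := by
  obtain ⟨M, m, n, hM⟩ := exists_realisation δ'
  obtain ⟨p, hp, hp'⟩ := h.exists_iso_mid hM a c hδ
  have hm : m ≫ p.inv ≫ b.hom = x' := by
    rw [← cancel_epi a.hom, ← reassoc_of% hp, p.hom_inv_id_assoc, hx]
  have hn : b.inv ≫ p.hom ≫ n = y' := by
    rw [← hp', hy, b.inv_hom_id_assoc]
  simpa [hm, hn] using hM.comp_iso (p.symm ≪≫ b)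

end Isomorphisms

theorem biprod_map_id (h : 𝓔.IsETriangle x y δ) (Y : 𝒞) :
    𝓔.IsETriangle (biprod.map x (𝟙 Y)) (biprod.fst ≫ y) (push 𝓔.𝔼 biprod.inl δ) := by
  have hsum : 𝓔.IsETriangle (biprod.map x (𝟙 Y)) (biprod.map y (0 : Y ⟶ (0 : 𝒞)))
      (push 𝓔.𝔼 biprod.inl (pull 𝓔.𝔼 biprod.fst δ)) := by
    simpa only [IsETriangle, push_zero, pull_zero, add_zero] using
      𝓔.realisation_add δ 0 _ _ _ _ h (id_zero Y)
  exact hsum.of_iso (Iso.refl _) (Iso.refl _) (isoBiprodZero (isZero_zero 𝒞)).symm (by simp)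
    (by simp) (by simp [push_pull])

theorem exists_mappingCone (h : 𝓔.IsETriangle x y δ) {Y : 𝒞} (u : A ⟶ Y) :
    ∃ (Z : 𝒞) (v : B ⊞ Y ⟶ Z) (w : Z ⟶ C), 𝓔.IsETriangle (biprod.lift x u) v (pull 𝓔.𝔼 w δ) ∧
      𝓔.IsETriangle (biprod.inr ≫ v) w (-push 𝓔.𝔼 u δ) := by
  obtain ⟨Z, v, d, w, ε, hd, -, hε, hw, -, hεw⟩ :=
    𝓔.et4 0 _ _ _ _ _ (graph u) (h.biprod_map_id Y)
  have hdv : d = biprod.inr ≫ v := by simpa using congrArg (biprod.inr ≫ ·) hd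
  have hε_eq : ε = pull 𝓔.𝔼 w δ := by
    simpa [push_pull, ← push_comp] using congrArg (push 𝓔.𝔼 biprod.fst) hεw
  have hlift : biprod.lift (𝟙 A) u ≫ biprod.map x (𝟙 Y) = biprod.lift x u := by ext <;> simp
  rw [hlift, hε_eq] at hε
  rw [← push_comp, biprod.inl_desc, neg_push, hdv] at hw
  exact ⟨Z, v, w, hε, hw⟩

end IsETriangle

/-- An extension is universal if it is realised by `A ⟶ 0 ⟶ C`. It then exhibits `C` as a suspension
of `A`: in a triangulated category these are the extensions given by isomorphisms `C ≅ T A`. -/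
def IsUniversal (𝓔 : ExtriangulatedStructure.{w} 𝒞) {A C : 𝒞} (δ : Ext 𝓔.𝔼 C A) : Prop :=
  𝓔.IsETriangle (0 : A ⟶ (0 : 𝒞)) (0 : (0 : 𝒞) ⟶ C) δ

theorem IsInflation.exists_isUniversal {A : 𝒞} (h : 𝓔.IsInflation (0 : A ⟶ (0 : 𝒞))) :
    ∃ (C : 𝒞) (δ : Ext 𝓔.𝔼 C A), 𝓔.IsUniversal δ := by
  obtain ⟨C, y, δ, hδ⟩ := h
  obtain rfl : y = 0 := (isZero_zero 𝒞).eq_of_src _ _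
  exact ⟨C, δ, hδ⟩

theorem IsDeflation.exists_isUniversal {C : 𝒞} (h : 𝓔.IsDeflation (0 : (0 : 𝒞) ⟶ C)) :
    ∃ (A : 𝒞) (δ : Ext 𝓔.𝔼 C A), 𝓔.IsUniversal δ := by
  obtain ⟨A, x, δ, hδ⟩ := h
  obtain rfl : x = 0 := (isZero_zero 𝒞).eq_of_tgt _ _
  exact ⟨A, δ, hδ⟩

namespace IsUniversal

variable {A C W : 𝒞} {δ : Ext 𝓔.𝔼 C A}

theorem exists_pull_eq (h : 𝓔.IsUniversal δ) (ε : Ext 𝓔.𝔼 W A) :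
    ∃ c : W ⟶ C, pull 𝓔.𝔼 c δ = ε :=
  IsETriangle.exists_pull_eq h ε (𝓔.zero_push ε)

theorem exists_push_eq (h : 𝓔.IsUniversal δ) (ε : Ext 𝓔.𝔼 C W) :
    ∃ a : A ⟶ W, push 𝓔.𝔼 a δ = ε :=
  IsETriangle.exists_push_eq h ε (𝓔.zero_pull ε)

theorem pull_inj (h : 𝓔.IsUniversal δ) {c c' : W ⟶ C} :
    pull 𝓔.𝔼 c δ = pull 𝓔.𝔼 c' δ ↔ c = c' := by
  refine ⟨fun hc => ?_, fun hc => hc ▸ rfl⟩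
  obtain ⟨s, hs⟩ := IsETriangle.exists_lift h (c - c') (by rw [sub_pull, hc, sub_self])
  rw [← sub_eq_zero, ← hs, comp_zero]

theorem push_inj (h : 𝓔.IsUniversal δ) {a a' : A ⟶ W} :
    push 𝓔.𝔼 a δ = push 𝓔.𝔼 a' δ ↔ a = a' := by
  refine ⟨fun ha => ?_, fun ha => ha ▸ rfl⟩
  obtain ⟨s, hs⟩ := IsETriangle.exists_extend h (a - a') (by rw [sub_push, ha, sub_self])
  rw [← sub_eq_zero, ← hs, zero_comp]

theorem exists_cone (h : 𝓔.IsUniversal δ) {Y : 𝒞} (u : A ⟶ Y) :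
    ∃ (Z : 𝒞) (v : Y ⟶ Z) (w : Z ⟶ C), 𝓔.IsETriangle u v (pull 𝓔.𝔼 w δ) ∧
      𝓔.IsETriangle v w (-push 𝓔.𝔼 u δ) := by
  obtain ⟨Z, v, w, hu, hw⟩ := IsETriangle.exists_mappingCone h u
  refine ⟨Z, biprod.inr ≫ v, w, ?_, hw⟩
  simpa using hu.comp_iso (isoZeroBiprod (isZero_zero 𝒞)).symm

end IsUniversal

/-- A suspension functor for `𝓔`: a functor `T` with universal extensions in `𝔼(T X, X)` which are
natural in `X`, so that `T X` represents `𝔼(-, X)`. -/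
structure Suspension (𝓔 : ExtriangulatedStructure.{w} 𝒞) where
  /-- the functor `X ↦ T X` -/
  T : 𝒞 ⥤ 𝒞
  /-- the universal extension of `T X` by `X` -/
  ext (X : 𝒞) : Ext 𝓔.𝔼 (T.obj X) X
  isUniversal (X : 𝒞) : 𝓔.IsUniversal (ext X)
  pull_map {X Y : 𝒞} (f : X ⟶ Y) : pull 𝓔.𝔼 (T.map f) (ext Y) = push 𝓔.𝔼 f (ext X)

namespace Suspension

theorem nonempty_of_isInflation (h : ∀ X : 𝒞, 𝓔.IsInflation (0 : X ⟶ (0 : 𝒞))) :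
    Nonempty 𝓔.Suspension := by
  choose obj ext hext using fun X => (h X).exists_isUniversal
  choose map hmap using fun {X Y : 𝒞} (f : X ⟶ Y) =>
    (hext Y).exists_pull_eq (push 𝓔.𝔼 f (ext X))
  exact ⟨{
    T :=
      { obj := obj
        map := map
        map_id X := (hext X).pull_inj.1 (by rw [hmap, push_id, pull_id])
        map_comp f g := (hext _).pull_inj.1
          (by rw [hmap, pull_comp, hmap, ← push_pull, hmap, push_comp]) }
    ext := ext
    isUniversal := hext
    pull_map := hmap }⟩

variable (S : 𝓔.Suspension)

theorem isEquivalence (h : ∀ X : 𝒞, 𝓔.IsDeflation (0 : (0 : 𝒞) ⟶ X)) : S.T.IsEquivalence where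
  faithful := ⟨fun {X Y f g} hfg => by
    rw [← (S.isUniversal X).push_inj, ← S.pull_map, hfg, S.pull_map]⟩
  full := ⟨fun {X Y} g => by
    obtain ⟨f, hf⟩ := (S.isUniversal X).exists_push_eq (pull 𝓔.𝔼 g (S.ext Y))
    exact ⟨f, by rw [← (S.isUniversal Y).pull_inj, S.pull_map, hf]⟩⟩
  essSurj := ⟨fun Y => by
    obtain ⟨X, δ, hδ⟩ := (h Y).exists_isUniversal
    obtain ⟨c, -⟩ := IsETriangle.exists_iso_right (S.isUniversal X) hδ
    exact ⟨X, ⟨c⟩⟩⟩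

/-- The distinguished triangles for the suspension functor `T`: those `X ⟶ Y ⟶ Z ⟶ T X` for which
`X ⟶ Y ⟶ Z` realises the extension classified by `Z ⟶ T X`. -/
def Dist {X Y Z : 𝒞} (u : X ⟶ Y) (v : Y ⟶ Z) (w : Z ⟶ S.T.obj X) : Prop :=
  𝓔.IsETriangle u v (pull 𝓔.𝔼 w (S.ext X))

theorem dist_id (X : 𝒞) : S.Dist (𝟙 X) (0 : X ⟶ (0 : 𝒞)) 0 := by
  simpa only [Dist, zero_pull] using IsETriangle.id_zero X

theorem exists_dist_rotate {X Y : 𝒞} (u : X ⟶ Y) :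
    ∃ (Z : 𝒞) (v : Y ⟶ Z) (w : Z ⟶ S.T.obj X), S.Dist u v w ∧ S.Dist v w (-S.T.map u) := by
  obtain ⟨Z, v, w, hu, hv⟩ := (S.isUniversal X).exists_cone u
  rw [← S.pull_map, ← neg_pull] at hv
  exact ⟨Z, v, w, hu, hv⟩

namespace Dist

variable {S} {X Y Z X' Y' Z' : 𝒞} {u : X ⟶ Y} {v : Y ⟶ Z} {w : Z ⟶ S.T.obj X}
  {u' : X' ⟶ Y'} {v' : Y' ⟶ Z'} {w' : Z' ⟶ S.T.obj X'}

theorem of_iso (H : S.Dist u v w) (f : X ≅ X') (g : Y ≅ Y') (h : Z ≅ Z')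
    (hu : u ≫ g.hom = f.hom ≫ u') (hv : v ≫ h.hom = g.hom ≫ v')
    (hw : w ≫ S.T.map f.hom = h.hom ≫ w') : S.Dist u' v' w' :=
  IsETriangle.of_iso H f g h hu hv
    (by rw [push_pull, ← S.pull_map, ← pull_comp, ← pull_comp, hw])

theorem exists_iso {v' : Y ⟶ Z'} {w' : Z' ⟶ S.T.obj X} (H : S.Dist u v w) (H' : S.Dist u v' w') :
    ∃ h : Z ≅ Z', v ≫ h.hom = v' ∧ h.hom ≫ w' = w := by
  obtain ⟨h, hv, hw⟩ := IsETriangle.exists_iso_right H H'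
  exact ⟨h, hv, by rw [← (S.isUniversal X).pull_inj, pull_comp, hw]⟩

theorem rotate (H : S.Dist u v w) : S.Dist v w (-S.T.map u) := by
  obtain ⟨Z₀, v₀, w₀, H₀, H₀'⟩ := S.exists_dist_rotate u
  obtain ⟨φ, hv, hw⟩ := H₀.exists_iso H
  exact H₀'.of_iso (Iso.refl _) φ (Iso.refl _) (by simp [hv]) (by simp [hw]) (by simp)

theorem exists_hom (H : S.Dist u v w) (H' : S.Dist u' v' w') (f : X ⟶ X') (g : Y ⟶ Y')
    (hu : u ≫ g = f ≫ u') : ∃ h : Z ⟶ Z', v ≫ h = g ≫ v' ∧ w ≫ S.T.map f = h ≫ w' := by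
  obtain ⟨h, hδ, hv⟩ := 𝓔.et3 _ _ _ _ _ _ H H' f g hu
  refine ⟨h, hv, (S.isUniversal X').pull_inj.1 ?_⟩
  rw [pull_comp, S.pull_map, ← push_pull, hδ, pull_comp]

theorem octahedron {X Y Z X' Y' Z' : 𝒞} {u : X ⟶ Y} {i : Y ⟶ Z'} {i' : Z' ⟶ S.T.obj X}
    {v : Y ⟶ Z} {j : Z ⟶ X'} {j' : X' ⟶ S.T.obj Y} {k : Z ⟶ Y'} {k' : Y' ⟶ S.T.obj X}
    (Hu : S.Dist u i i') (Hv : S.Dist v j j') (Huv : S.Dist (u ≫ v) k k') :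
    ∃ (f : Z' ⟶ Y') (g : Y' ⟶ X'), i ≫ f = v ≫ k ∧ f ≫ k' = i' ∧ k ≫ g = j ∧
      k' ≫ S.T.map u = g ≫ j' ∧ S.Dist f g (j' ≫ S.T.map i) := by
  obtain ⟨E, h, d, e, ε, hd, he, hε, hde, hdε, hue⟩ := 𝓔.et4 _ _ _ _ _ _ Hu Hv
  -- (ET4) makes its own choice of a cone of `u ≫ v`, which `φ` identifies with the given one.
  obtain ⟨φ, hφ, hφε⟩ := IsETriangle.exists_iso_right hε Huv
  have hk' : pull 𝓔.𝔼 k' (S.ext X) = pull 𝓔.𝔼 φ.inv ε := by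
    rw [← hφε, ← pull_comp, φ.inv_hom_id, pull_id]
  refine ⟨d ≫ φ.hom, φ.inv ≫ e, ?_, (S.isUniversal X).pull_inj.1 ?_, ?_,
    (S.isUniversal Y).pull_inj.1 ?_, ?_⟩
  · rw [reassoc_of% hd, hφ]
  · rw [Category.assoc, pull_comp, pull_comp, hφε, hdε]
  · rw [← hφ, Category.assoc, φ.hom_inv_id_assoc, he]
  · rw [pull_comp, S.pull_map, ← push_pull, hk', push_pull, hue, Category.assoc, pull_comp,
      pull_comp]
  · rw [Dist, pull_comp, S.pull_map, ← push_pull]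
    exact IsETriangle.comp_iso hde φ

end Dist

/-- The triangulated structure whose shift is a suspension functor for `𝓔`. -/
def triangulatedStructure (h : ∀ X : 𝒞, 𝓔.IsDeflation (0 : (0 : 𝒞) ⟶ X)) :
    TriangulatedStructure 𝒞 where
  T := S.T
  isEquivalence := S.isEquivalence h
  Dist := S.Dist
  tr1_iso _ _ _ _ _ _ f g h hu hv hw H := H.of_iso f g h hu hv hw
  tr1_exists u := by
    obtain ⟨Z, v, w, H, -⟩ := S.exists_dist_rotate u
    exact ⟨Z, v, w, H⟩
  tr1_id := S.dist_id
  tr2 _ _ _ H := H.rotate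
  tr3 _ _ _ _ _ _ H H' f g hu := H.exists_hom H' f g hu
  tr4 _ _ _ _ _ _ _ _ Hu Hv Huv := Hu.octahedron Hv Huv

theorem isCompatible_triangulatedStructure (h : ∀ X : 𝒞, 𝓔.IsDeflation (0 : (0 : 𝒞) ⟶ X)) :
    (S.triangulatedStructure h).IsCompatible 𝓔 :=
  fun _ _ w H => ⟨pull 𝓔.𝔼 w (S.ext _), H⟩

end Suspension

end ExtriangulatedStructure

namespace TriangulatedStructure

variable {𝒞 : Type u} [Category.{v} 𝒞] [Preadditive 𝒞] [HasZeroObject 𝒞]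
  [HasBinaryBiproducts 𝒞] (𝓣 : TriangulatedStructure 𝒞)

theorem exists_dist_zero_zero (X : 𝒞) :
    ∃ (Y : 𝒞) (w : X ⟶ 𝓣.T.obj Y), 𝓣.Dist (0 : Y ⟶ (0 : 𝒞)) (0 : (0 : 𝒞) ⟶ X) w := by
  have := 𝓣.isEquivalence
  let Y := 𝓣.T.objPreimage X
  let e : 𝓣.T.obj Y ≅ X := 𝓣.T.objObjPreimageIso X
  have H : 𝓣.Dist (0 : Y ⟶ (0 : 𝒞)) 0 (-𝓣.T.map (𝟙 Y)) := 𝓣.tr2 _ _ _ (𝓣.tr1_id Y)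
  exact ⟨Y, -e.inv, 𝓣.tr1_iso _ _ _ _ _ _ (Iso.refl Y) (Iso.refl _) e (by simp) (by simp)
    (by simp) H⟩

variable {𝓣} {𝓔 : ExtriangulatedStructure.{w} 𝒞}

theorem IsCompatible.isInflation (h : 𝓣.IsCompatible 𝓔) {X Y : 𝒞} (f : X ⟶ Y) :
    𝓔.IsInflation f := by
  obtain ⟨Z, v, w, H⟩ := 𝓣.tr1_exists f
  exact ⟨Z, v, h _ _ _ H⟩

theorem IsCompatible.isDeflation_zero (h : 𝓣.IsCompatible 𝓔) (X : 𝒞) :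
    𝓔.IsDeflation (0 : (0 : 𝒞) ⟶ X) := by
  obtain ⟨Y, w, H⟩ := 𝓣.exists_dist_zero_zero X
  exact ⟨Y, 0, h _ _ _ H⟩

end TriangulatedStructure

theorem theorem3p1 {𝒞 : Type u} [Category.{v} 𝒞] [Preadditive 𝒞] [HasZeroObject 𝒞]
    [HasBinaryBiproducts 𝒞] (𝓔 : ExtriangulatedStructure.{w} 𝒞) :
    (∃ 𝓣 : TriangulatedStructure 𝒞, 𝓣.IsCompatible 𝓔) ↔
      ∀ X : 𝒞, 𝓔.IsInflation (0 : X ⟶ (0 : 𝒞)) ∧ 𝓔.IsDeflation (0 : (0 : 𝒞) ⟶ X) := by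
  constructor
  · rintro ⟨𝓣, h𝓣⟩ X
    exact ⟨h𝓣.isInflation 0, h𝓣.isDeflation_zero X⟩
  · intro h
    obtain ⟨S⟩ := ExtriangulatedStructure.Suspension.nonempty_of_isInflation fun X => (h X).1
    exact ⟨S.triangulatedStructure fun X => (h X).2, S.isCompatible_triangulatedStructure _⟩
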